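/- For a group $A$ write $[x,y]=x^{-1}y^{-1}xy$, $x^z=z^{-1}xz$, and let $A'$ be the commutator subgroup of $A$. For $n\ge 2$ let \[K(A,n)=\{(a_1,\dots,a_n)\in A^n : a_1\cdots a_n\in A'\}.\] For a finite group $G$, choose a free group $F$ of finite rank and a normal subgroup $N\unlhd F$ with $F/N\cong G$, and let $\tilde K(G,n)=K(F,n)/K(N,n)^{F^n}$, where $K(N,n)^{F^n}$ is the normal closure of $K(N,n)$ in $F^n$ (the isomorphism type does not depend on the choice of the presentation). Let $G^*$ be an isomorphic copy of $G$ via $g\mapsto g^*$, let $\nu(G)$ be the quotient of the free product $G\star G^*$ by the normal closure of all elements \[[x,y^*]^{z}\,[x^z,(y^z)^*]^{-1}\quad\text{and}\quad [x,y^*]^{z^*}\,[x^z,(y^z)^*]^{-1}\qquad(x,y,z\in G),\] let $\nabla(G)$ be the (normal) subgroup of $\nu(G)$ generated by all $[x,x^*]$ with $x\in G$, and let $\tau(G)=\nu(G)/\nabla(G)$. The rank of a finite abelian $p$-group is the minimal number of its generators. Let $G$ be a finite abelian group. (a) Suppose that for every prime $p$ the Sylow $p$-subgroup of $G$ has rank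 at most $2$. Then $\tau(G)\cong\tilde K(G,3)$ if and only if the Sylow $3$-subgroup of $G$ is cyclic. (b) If the Sylow $3$-subgroup of $G$ has rank at least $2$, then $\tau(G)\not\cong\tilde K(G,3)$. -/

import Mathlib

namespace LiedtkeTau

/-- The commutator `[x, y] = x⁻¹ y⁻¹ x y`. -/
def comm {A : Type*} [Group A] (x y : A) : A := x⁻¹ * y⁻¹ * x * y

/-- The conjugate `x ^ z = z⁻¹ x z`. -/
def conj {A : Type*} [Group A] (x z : A) : A := z⁻¹ * x * z

section Liedtke

/-- The homomorphism `Gⁿ → G / G'` sending `(g₁, …, gₙ)` to the class of `g₁ ⋯ gₙ`. -/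
def prodAb (G : Type*) [Group G] (n : ℕ) : (Fin n → G) →* Abelianization G where
  toFun g := ∏ i, Abelianization.of (g i)
  map_one' := by simp
  map_mul' g h := by simp [Finset.prod_mul_distrib]

/-- `K(G, n)`, the kernel of `Gⁿ → G / G'`. -/
def K (G : Type*) [Group G] (n : ℕ) : Subgroup (Fin n → G) := (prodAb G n).ker

instance K_normal (G : Type*) [Group G] (n : ℕ) : (K G n).Normal :=
  inferInstanceAs (prodAb G n).ker.Normal

/-- Membership in `K(G, n)`: the ordered product of the entries lies in `G'`. -/
theorem mem_K_iff {G : Type*} [Group G] {n : ℕ} (g : Fin n → G) :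
    g ∈ K G n ↔ (List.ofFn g).prod ∈ commutator G := by
  rw [← Abelianization.ker_of, MonoidHom.mem_ker, map_list_prod, List.map_ofFn, List.prod_ofFn]
  exact Iff.rfl

/-- `K(N, n)` for a subgroup `N ≤ F`, regarded as a subgroup of `Fⁿ`. -/
def KSub {F : Type*} [Group F] (N : Subgroup F) (n : ℕ) : Subgroup (Fin n → F) :=
  (K N n).map (N.subtype.compLeft (Fin n))

/-- The normal closure of `K(N, n)` in `Fⁿ`. -/
def KSubClosure {F : Type*} [Group F] (N : Subgroup F) (n : ℕ) : Subgroup (Fin n → F) :=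
  Subgroup.normalClosure (KSub N n : Set (Fin n → F))

instance KSubClosure_normal {F : Type*} [Group F] (N : Subgroup F) (n : ℕ) :
    (KSubClosure N n).Normal :=
  Subgroup.normalClosure_normal

/-- The normal closure of `K(N, n)` in `Fⁿ` is contained in `K(F, n)`, so that the quotient
formed in `KTilde` is by this whole subgroup. -/
theorem KSubClosure_le {F : Type*} [Group F] (N : Subgroup F) (n : ℕ) :
    KSubClosure N n ≤ K F n := by
  refine Subgroup.normalClosure_le_normal ?_
  rintro _ ⟨g, hg, rfl⟩
  have h : Abelianization.map N.subtype (prodAb N n g) = 1 := by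
    rw [show prodAb N n g = 1 from hg, map_one]
  change prodAb F n _ = 1
  rw [← h]
  simp [prodAb, MonoidHom.compLeft]

/-- For a presentation `π : F → G` with kernel `N` (in the applications `F` is free and `π` is
surjective), the group `K̃(G, n) = K(F, n) / K(N, n) ^ (Fⁿ)`. -/
abbrev KTilde {F G : Type*} [Group F] [Group G] (π : F →* G) (n : ℕ) : Type _ :=
  K F n ⧸ (KSubClosure π.ker n).subgroupOf (K F n)

end Liedtke

section Tau

open Monoid.Coprod

/-- The defining relators of `ν(G)` in the free product of `G` with a copy `G*` of itself; the
two copies are embedded by `inl` and `inr`. -/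
def nuRelators (G : Type*) [Group G] : Set (Monoid.Coprod G G) :=
  {r | ∃ x y z : G,
    r = conj (comm (inl x) (inr y)) (inl z) * (comm (inl (conj x z)) (inr (conj y z)))⁻¹ ∨
    r = conj (comm (inl x) (inr y)) (inr z) * (comm (inl (conj x z)) (inr (conj y z)))⁻¹}

/-- The group `ν(G)`. -/
abbrev Nu (G : Type*) [Group G] : Type _ :=
  Monoid.Coprod G G ⧸ Subgroup.normalClosure (nuRelators G)

/-- The image in `ν(G)` of an element of the first copy of `G`. -/
def nuInl {G : Type*} [Group G] (x : G) : Nu G := QuotientGroup.mk (inl x)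

/-- The image in `ν(G)` of an element of the second copy of `G`. -/
def nuInr {G : Type*} [Group G] (x : G) : Nu G := QuotientGroup.mk (inr x)

/-- The subgroup `∇(G)` of `ν(G)` generated by the elements `[x, x*]`. -/
def nabla (G : Type*) [Group G] : Subgroup (Nu G) :=
  Subgroup.closure (Set.range fun x : G => comm (nuInl x) (nuInr x))

theorem conj_nuInl {G : Type*} [Group G] (x y z : G) :
    conj (comm (nuInl x) (nuInr y)) (nuInl z) =
      comm (nuInl (conj x z)) (nuInr (conj y z)) := by
  rw [← mul_inv_eq_one]
  exact (QuotientGroup.eq_one_iff _).2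
    (Subgroup.subset_normalClosure ⟨x, y, z, Or.inl rfl⟩)

theorem conj_nuInr {G : Type*} [Group G] (x y z : G) :
    conj (comm (nuInl x) (nuInr y)) (nuInr z) =
      comm (nuInl (conj x z)) (nuInr (conj y z)) := by
  rw [← mul_inv_eq_one]
  exact (QuotientGroup.eq_one_iff _).2
    (Subgroup.subset_normalClosure ⟨x, y, z, Or.inr rfl⟩)

instance nabla_normal (G : Type*) [Group G] : (nabla G).Normal := by
  have key : ∀ w : Nu G, ∀ x : G, ∃ y : G,
      w * comm (nuInl x) (nuInr x) * w⁻¹ = comm (nuInl y) (nuInr y) := by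
    intro w
    induction w using QuotientGroup.induction_on with
    | H w =>
      induction w using Monoid.Coprod.induction_on with
      | inl z =>
        intro x
        refine ⟨conj x z⁻¹, ?_⟩
        rw [← conj_nuInl]
        simp [conj, nuInl]
      | inr z =>
        intro x
        refine ⟨conj x z⁻¹, ?_⟩
        rw [← conj_nuInr]
        simp [conj, nuInr]
      | mul a b ha hb =>
        intro x
        obtain ⟨y, hy⟩ := hb x
        obtain ⟨z, hz⟩ := ha y
        refine ⟨z, ?_⟩
        rw [← hz, ← hy, QuotientGroup.mk_mul]
        group
  refine ⟨fun n hn w => ?_⟩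
  induction hn using Subgroup.closure_induction with
  | mem a ha =>
    obtain ⟨x, rfl⟩ := ha
    obtain ⟨y, hy⟩ := key w x
    exact hy ▸ Subgroup.subset_closure ⟨y, rfl⟩
  | one => simp
  | mul a b _ _ ha hb => simpa [mul_assoc] using (nabla G).mul_mem ha hb
  | inv a _ ha => simpa [mul_assoc] using (nabla G).inv_mem ha

/-- The group `τ(G) = ν(G) / ∇(G)`. -/
abbrev Tau (G : Type*) [Group G] : Type _ := Nu G ⧸ nabla G

end Tau

end LiedtkeTau

/-! Let `N` be the kernel of `π : F → G`. Commutators in `F / [N, F]` depend only on images in `G`;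
this gives an alternating form `pairing` on `G`. As `F` is free, every antisymmetrised
bimultiplicative map on `G` vanishes wherever `pairing` does (`eq_swap_of_pairing_eq_one`). A triple
lies in the normal closure of `K(N, 3)` iff its entries lie in `N` and its product in `[N, F]`, so
commutation in `K̃(G, 3)` is governed by a product of three values of `pairing`.

Obstruction: let `Q` be `G` modulo the radical of `pairing`. A Heisenberg group shows that `τ(G)`
maps onto `Q × Q` with the centre in the kernel, while `u ↦ (u₀/u₁, u₁/u₂)` maps `K̃(G, 3)` to `Q ×
Q` with central kernel. If the groups are isomorphic, counting makes the second map onto, and a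
preimage of `(a, 1)` shows that `a` is a cube in `Q`. A noncyclic Sylow 3-subgroup yields two
independent characters of order 3, whose antisymmetrised product is nonzero but blind to cubes: a
contradiction.

Converse: under the hypotheses of (a), `G ≅ A × B` with both factors cyclic and `|B|` prime to 3.
Two homomorphisms `α, β` from `A × B` to `K̃`, given by explicit integer exponents, satisfy the
relations of `τ`. The exponent matrices have determinant 1 on `A` and −3 on `B`, so cubing being
bijective on `B` makes the induced map an isomorphism. -/

namespace LiedtkeTau

/-! ### Commutator identities when commutators are central -/

section Comm

variable {A : Type*} [Group A]

theorem comm_eq_one_iff {x y : A} : comm x y = 1 ↔ x * y = y * x := by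
  rw [comm, mul_assoc, ← mul_inv_rev, inv_mul_eq_one, eq_comm]

theorem comm_self (x : A) : comm x x = 1 := comm_eq_one_iff.2 rfl

theorem inv_comm (x y : A) : (comm x y)⁻¹ = comm y x := by
  simp [comm, mul_assoc]

theorem map_comm {B : Type*} [Group B] (f : A →* B) (x y : A) :
    f (comm x y) = comm (f x) (f y) := by
  simp [comm]

theorem comm_eq_one_of_mem_center_left {x : A} (hx : x ∈ Subgroup.center A) (y : A) :
    comm x y = 1 :=
  comm_eq_one_iff.2 (Subgroup.mem_center_iff.1 hx y).symm

theorem mem_center_of_comm {x : A} (h : ∀ y, comm x y = 1) : x ∈ Subgroup.center A :=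
  Subgroup.mem_center_iff.2 fun y => (comm_eq_one_iff.1 (h y)).symm

theorem comm_mul_left {x z : A} (hc : comm x z ∈ Subgroup.center A) (y : A) :
    comm (x * y) z = comm x z * comm y z := by
  have h : comm (x * y) z = y⁻¹ * comm x z * (z⁻¹ * y * z) := by simp [comm, mul_assoc]
  rw [h, Subgroup.mem_center_iff.1 hc]
  simp [comm, mul_assoc]

theorem comm_mul_right {x y : A} (hc : comm x y ∈ Subgroup.center A) (z : A) :
    comm x (y * z) = comm x y * comm x z := by
  have hc' : comm y x ∈ Subgroup.center A := inv_comm x y ▸ inv_mem hc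
  rw [← inv_comm, comm_mul_left hc', mul_inv_rev, inv_comm, inv_comm,
    Subgroup.mem_center_iff.1 hc]

end Comm

/-! ### Central extensions defined by bimultiplicative cocycles -/

section CocycleGroup

variable {A W : Type*} [CommGroup A] [CommGroup W]

/-- The central extension of `A` by `W` with the bimultiplicative cocycle `β`. -/
structure CocycleGroup (β : A →* A →* W) where
  /-- The component in the quotient. -/
  fst : A
  /-- The component in the central kernel. -/
  snd : W

namespace CocycleGroup

variable {β : A →* A →* W}

@[ext] theorem ext' {p q : CocycleGroup β} (h₁ : p.fst = q.fst) (h₂ : p.snd = q.snd) : p = q := by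
  cases p; cases q; simp_all

instance : Mul (CocycleGroup β) := ⟨fun p q => ⟨p.fst * q.fst, p.snd * q.snd * β p.fst q.fst⟩⟩
instance : One (CocycleGroup β) := ⟨⟨1, 1⟩⟩
-- The factor `β p.fst p.fst` cancels `β p.fst⁻¹ p.fst`.
instance : Inv (CocycleGroup β) := ⟨fun p => ⟨p.fst⁻¹, p.snd⁻¹ * β p.fst p.fst⟩⟩

@[simp] theorem mul_fst (p q : CocycleGroup β) : (p * q).fst = p.fst * q.fst := rfl
@[simp] theorem mul_snd (p q : CocycleGroup β) :
    (p * q).snd = p.snd * q.snd * β p.fst q.fst := rfl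
@[simp] theorem one_fst : (1 : CocycleGroup β).fst = 1 := rfl
@[simp] theorem one_snd : (1 : CocycleGroup β).snd = 1 := rfl
@[simp] theorem inv_fst (p : CocycleGroup β) : p⁻¹.fst = p.fst⁻¹ := rfl
@[simp] theorem inv_snd (p : CocycleGroup β) : p⁻¹.snd = p.snd⁻¹ * β p.fst p.fst := rfl

instance : Group (CocycleGroup β) :=
  Group.ofLeftAxioms
    (fun p q r => by
      ext
      · simp [mul_assoc]
      · simp only [mul_snd, mul_fst, map_mul, MonoidHom.mul_apply]
        generalize β p.fst q.fst = a, β p.fst r.fst = b, β q.fst r.fst = c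
        ac_rfl)
    (fun p => by ext <;> simp)
    (fun p => by ext <;> simp)

/-- The projection to the quotient. -/
@[simps] def fstHom (β : A →* A →* W) : CocycleGroup β →* A where
  toFun := fst
  map_one' := rfl
  map_mul' _ _ := rfl

/-- The commutator in the extension is the antisymmetrisation of the cocycle. -/
theorem mul_comm_iff (p q : CocycleGroup β) :
    p * q = q * p ↔ β p.fst q.fst = β q.fst p.fst := by
  constructor
  · intro h
    have := congrArg snd h
    rw [mul_snd, mul_snd, mul_comm q.snd] at this
    exact mul_left_cancel this
  · intro h
    ext
    · exact mul_comm _ _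
    · rw [mul_snd, mul_snd, mul_comm q.snd, h]

end CocycleGroup

end CocycleGroup

theorem form_swap {G W : Type*} [CommGroup G] [CommGroup W] {ω : G →* G →* W} (hω : ∀ a, ω a a = 1) (a b : G) :
    ω b a = (ω a b)⁻¹ := by
  have := hω (a * b)
  rw [map_mul, map_mul, MonoidHom.mul_apply, MonoidHom.mul_apply, hω, hω,
    one_mul, mul_one] at this
  exact eq_inv_of_mul_eq_one_left this

/-! ### The commutator pairing of a presentation -/

section Pairing

open scoped IsMulCommutative

variable {F G : Type*} [Group F] [CommGroup G] (π : F →* G)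

/-- The central extension `F / [N, F]` of `G`, where `N = ker π`. -/
abbrev CentralQuotient : Type _ := F ⧸ ⁅π.ker, (⊤ : Subgroup F)⁆

theorem mk_mem_center {n : F} (hn : π n = 1) :
    (n : CentralQuotient π) ∈ Subgroup.center (CentralQuotient π) := by
  refine Subgroup.mem_center_iff.2 fun g => ?_
  induction g using QuotientGroup.induction_on with
  | H g =>
    refine QuotientGroup.eq.2 ?_
    have := Subgroup.commutator_mem_commutator (inv_mem (show n ∈ π.ker from hn))
      (Subgroup.mem_top g⁻¹)
    convert this using 1
    simp [commutatorElement_def, mul_assoc]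

/-- Lifts of the same element of `G` differ by an element of `N`, which is central in `F / [N, F]`
and drops out of commutators. -/
theorem mk_comm_congr {e e' f f' : F} (he : π e = π e') (hf : π f = π f') :
    ((comm e f : F) : CentralQuotient π) = (comm e' f' : F) := by
  have key : ∀ {e e' : F} (f : F), π e = π e' →
      ((comm e f : F) : CentralQuotient π) = (comm e' f : F) := by
    intro e e' f h
    obtain ⟨n, hn, rfl⟩ : ∃ n, π n = 1 ∧ e' = n * e := ⟨e' * e⁻¹, by simp [h], by simp⟩
    have hz := mk_mem_center π hn
    change QuotientGroup.mk' _ _ = QuotientGroup.mk' _ _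
    rw [map_comm, map_comm, map_mul]
    have hz' : comm (QuotientGroup.mk' _ n) (QuotientGroup.mk' _ f) = 1 :=
      comm_eq_one_of_mem_center_left hz (f : CentralQuotient π)
    rw [comm_mul_left (by rw [hz']; exact one_mem _), hz', one_mul]
  rw [key f he, ← inv_inj, ← QuotientGroup.mk_inv, ← QuotientGroup.mk_inv, inv_comm, inv_comm,
    key e' hf]

theorem mk_comm_mem_center (e f : F) :
    ((comm e f : F) : CentralQuotient π) ∈ Subgroup.center (CentralQuotient π) :=
  mk_mem_center π (by rw [map_comm, comm_eq_one_iff, mul_comm])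

theorem mk_comm_mul_left (e e' f : F) : ((comm (e * e') f : F) : CentralQuotient π) =
    (comm e f : F) * (comm e' f : F) := by
  have := mk_comm_mem_center π e f
  change QuotientGroup.mk' _ _ = QuotientGroup.mk' _ _ * QuotientGroup.mk' _ _
  change QuotientGroup.mk' _ _ ∈ _ at this
  simp only [map_comm, map_mul] at this ⊢
  exact comm_mul_left this _

theorem mk_comm_mul_right (e f f' : F) : ((comm e (f * f') : F) : CentralQuotient π) =
    (comm e f : F) * (comm e f' : F) := by
  have := mk_comm_mem_center π e f
  change QuotientGroup.mk' _ _ = QuotientGroup.mk' _ _ * QuotientGroup.mk' _ _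
  change QuotientGroup.mk' _ _ ∈ _ at this
  simp only [map_comm, map_mul] at this ⊢
  exact comm_mul_right this _

variable {π} (hπ : Function.Surjective π)

/-- The commutator pairing of `G` with values in the centre of `F / [N, F]`. -/
noncomputable def pairing : G →* G →* Subgroup.center (CentralQuotient π) :=
  MonoidHom.mk' (fun a => MonoidHom.mk' (fun b =>
      (⟨(comm (Function.surjInv hπ a) (Function.surjInv hπ b) : F), mk_comm_mem_center π _ _⟩ :
        Subgroup.center (CentralQuotient π)))
    (fun b b' => Subtype.ext (by
      change ((comm _ _ : F) : CentralQuotient π) = (comm _ _ : F) * (comm _ _ : F)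
      rw [← mk_comm_mul_right]
      exact mk_comm_congr π rfl (by simp [Function.surjInv_eq hπ]))))
  (fun a a' => MonoidHom.ext fun b => Subtype.ext (by
      change ((comm _ _ : F) : CentralQuotient π) = (comm _ _ : F) * (comm _ _ : F)
      rw [← mk_comm_mul_left]
      exact mk_comm_congr π (by simp [Function.surjInv_eq hπ]) rfl))

theorem pairing_apply (e f : F) :
    (pairing hπ (π e) (π f) : CentralQuotient π) = (comm e f : F) :=
  mk_comm_congr π (Function.surjInv_eq hπ _) (Function.surjInv_eq hπ _)

theorem pairing_self (a : G) : pairing hπ a a = 1 := by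
  obtain ⟨e, rfl⟩ := hπ a
  exact Subtype.ext (by rw [pairing_apply, comm_self]; rfl)

theorem pairing_swap (a b : G) : pairing hπ b a = (pairing hπ a b)⁻¹ :=
  form_swap (pairing_self hπ) a b

end Pairing

/-! ### Universality of the pairing for free presentations -/

section Detect

open scoped IsMulCommutative

variable {G X W : Type*} [CommGroup G] [CommGroup W] {π : FreeGroup X →* G}

/-- An alternating form that is the antisymmetrisation of a bimultiplicative map factors through
the commutator pairing. -/
theorem eq_swap_of_pairing_eq_one (hπ : Function.Surjective π) (β : G →* G →* W) {a b : G}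
    (h : pairing hπ a b = 1) : β a b = β b a := by
  obtain ⟨e, rfl⟩ := hπ a
  obtain ⟨f, rfl⟩ := hπ b
  -- Freeness lifts `π` to the cocycle group. There `N` lands in the central kernel, so `[N, F]`
  -- dies, and commuting means symmetry of `β`.
  let φ : FreeGroup X →* CocycleGroup β := FreeGroup.lift fun x => ⟨π (FreeGroup.of x), 1⟩
  have hφ : (CocycleGroup.fstHom β).comp φ = π := by
    ext x
    simp [φ]
  have hφ' : ∀ x, (φ x).fst = π x := fun x => DFunLike.congr_fun hφ x
  have hle : ⁅π.ker, (⊤ : Subgroup (FreeGroup X))⁆ ≤ φ.ker := by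
    rw [Subgroup.commutator_le]
    intro n hn x _
    rw [MonoidHom.mem_ker, map_commutatorElement, commutatorElement_eq_one_iff_mul_comm,
      CocycleGroup.mul_comm_iff, hφ', hφ', show π n = 1 from hn]
    simp
  have h1 : ((comm e f : FreeGroup X) : CentralQuotient π) = 1 := by
    rw [← pairing_apply hπ, h]; rfl
  have h2 := hle ((QuotientGroup.eq_one_iff _).1 h1)
  rwa [MonoidHom.mem_ker, map_comm, comm_eq_one_iff, CocycleGroup.mul_comm_iff, hφ', hφ'] at h2

end Detect

/-! ### Structure of `K̃(G, 3)` for abelian `G` -/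

section KTilde

open scoped IsMulCommutative

variable {F : Type*} [Group F]

theorem mem_K_three {e : Fin 3 → F} : e ∈ K F 3 ↔ e 0 * e 1 * e 2 ∈ commutator F := by
  rw [mem_K_iff]
  simp [List.ofFn_succ, mul_assoc]

theorem mem_KSub_three {N : Subgroup F} {a : Fin 3 → F} (ha : ∀ i, a i ∈ N)
    (h : a 0 * a 1 * a 2 = 1) : a ∈ KSub N 3 := by
  refine ⟨fun i => ⟨a i, ha i⟩, ?_, rfl⟩
  rw [SetLike.mem_coe, mem_K_three]
  convert one_mem (commutator N)
  exact Subtype.ext h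

theorem mulSingle_mem_KSubClosure {N : Subgroup F} {r : F} (hr : r ∈ ⁅N, (⊤ : Subgroup F)⁆) :
    Pi.mulSingle 0 r ∈ KSubClosure N 3 := by
  have : ⁅N, (⊤ : Subgroup F)⁆ ≤
      (KSubClosure N 3).comap (MonoidHom.mulSingle (fun _ : Fin 3 => F) 0) := by
    rw [Subgroup.commutator_le]
    intro n hn f _
    have h1 : (![n, n⁻¹, 1] : Fin 3 → F) ∈ KSubClosure N 3 := by
      refine Subgroup.subset_normalClosure (mem_KSub_three ?_ (by simp))
      intro i
      fin_cases i <;> simp [hn]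
    -- The commutator of `(n, n⁻¹, 1)` with `(f, 1, 1)` is `([n, f], 1, 1)`.
    have h2 := mul_mem h1 ((KSubClosure_normal N 3).conj_mem _ (inv_mem h1) (Pi.mulSingle 0 f))
    rw [Subgroup.mem_comap]
    convert h2 using 1
    ext i
    fin_cases i <;> simp [commutatorElement_def, mul_assoc]
  exact this hr

/-- The triples in the kernel of `π` whose product lies in `[N, F]`. -/
def kernelTriples {G : Type*} [CommGroup G] (π : F →* G) : Subgroup (Fin 3 → F) where
  carrier := {a | (∀ i, π (a i) = 1) ∧ ((a 0 * a 1 * a 2 : F) : CentralQuotient π) = 1}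
  one_mem' := by simp
  mul_mem' := by
    rintro a b ⟨ha, ha'⟩ ⟨hb, hb'⟩
    refine ⟨fun i => by simp [ha, hb], ?_⟩
    let A : Fin 3 → Subgroup.center (CentralQuotient π) := fun i => ⟨a i, mk_mem_center π (ha i)⟩
    let B : Fin 3 → Subgroup.center (CentralQuotient π) := fun i => ⟨b i, mk_mem_center π (hb i)⟩
    have hA : A 0 * A 1 * A 2 = 1 := Subtype.ext ha'
    have hB : B 0 * B 1 * B 2 = 1 := Subtype.ext hb'
    have h : (A 0 * B 0) * (A 1 * B 1) * (A 2 * B 2) = 1 := by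
      rw [mul_mul_mul_comm (A 0), mul_mul_mul_comm, hA, hB, one_mul]
    exact congrArg Subtype.val h
  inv_mem' := by
    rintro a ⟨ha, ha'⟩
    refine ⟨fun i => by simp [ha], ?_⟩
    let A : Fin 3 → Subgroup.center (CentralQuotient π) := fun i => ⟨a i, mk_mem_center π (ha i)⟩
    have hA : A 0 * A 1 * A 2 = 1 := Subtype.ext ha'
    have h : (A 0)⁻¹ * (A 1)⁻¹ * (A 2)⁻¹ = 1 := by
      rw [← mul_inv, ← mul_inv, hA, inv_one]
    exact congrArg Subtype.val h

instance kernelTriples_normal {G : Type*} [CommGroup G] (π : F →* G) :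
    (kernelTriples π).Normal := by
  refine ⟨?_⟩
  rintro a ⟨ha, ha'⟩ g
  refine ⟨fun i => by simp [ha], ?_⟩
  simp only [Pi.mul_apply, Pi.inv_apply, QuotientGroup.mk_mul, QuotientGroup.mk_inv] at ha' ⊢
  have : ∀ i, (g i : CentralQuotient π) * a i * (g i : CentralQuotient π)⁻¹ = a i := fun i => by
    rw [Subgroup.mem_center_iff.1 (mk_mem_center π (ha i)), mul_inv_cancel_right]
  rw [this, this, this, ha']

theorem KSubClosure_le_kernelTriples {G : Type*} [CommGroup G] (π : F →* G) :
    KSubClosure π.ker 3 ≤ kernelTriples π := by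
  refine Subgroup.normalClosure_le_normal ?_
  rintro _ ⟨g, hg, rfl⟩
  refine ⟨fun i => (g i).2, ?_⟩
  rw [SetLike.mem_coe, mem_K_three] at hg
  have h1 : ((g 0 * g 1 * g 2 : π.ker) : F) ∈ ⁅π.ker, π.ker⁆ := by
    rw [← Subgroup.map_subtype_commutator]
    exact ⟨_, hg, rfl⟩
  exact (QuotientGroup.eq_one_iff _).2 (Subgroup.commutator_mono le_rfl le_top h1)

theorem mem_KSubClosure_three {G : Type*} [CommGroup G] {π : F →* G} {a : Fin 3 → F} :
    a ∈ KSubClosure π.ker 3 ↔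
      (∀ i, π (a i) = 1) ∧ ((a 0 * a 1 * a 2 : F) : CentralQuotient π) = 1 := by
  constructor
  · intro h
    exact KSubClosure_le_kernelTriples π h
  · rintro ⟨ha, h⟩
    -- The triple is `(a₀a₁a₂, 1, 1)` times this one, whose product is 1.
    have h1 : (![(a 1 * a 2)⁻¹, a 1, a 2] : Fin 3 → F) ∈ KSubClosure π.ker 3 := by
      refine Subgroup.subset_normalClosure (mem_KSub_three ?_ (by simp [mul_assoc]))
      intro i
      fin_cases i <;> simp [ha, MonoidHom.mem_ker]
    convert mul_mem (mulSingle_mem_KSubClosure ((QuotientGroup.eq_one_iff _).1 h)) h1 using 1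
    ext i
    fin_cases i <;> simp [mul_assoc]

variable {G : Type*} [CommGroup G]

/-- The projection of `K̃(G, 3)` to `G³`. -/
def components (π : F →* G) : KTilde π 3 →* (Fin 3 → G) :=
  QuotientGroup.lift _ ((π.compLeft (Fin 3)).comp (K F 3).subtype) (by
    intro e he
    exact funext (mem_KSubClosure_three.1 (Subgroup.mem_subgroupOf.1 he)).1)

variable {π : F →* G}

theorem components_mk (e : K F 3) (i : Fin 3) :
    components π (QuotientGroup.mk e) i = π (e.1 i) := rfl

theorem components_prod (u : KTilde π 3) :
    components π u 0 * components π u 1 * components π u 2 = 1 := by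
  induction u using QuotientGroup.induction_on with
  | H e =>
    simp only [components_mk, ← map_mul]
    exact Abelianization.commutator_subset_ker π (mem_K_three.1 e.2)

theorem components_eq_of_eq {u v : KTilde π 3} (h0 : components π u 0 = components π v 0)
    (h1 : components π u 1 = components π v 1) : components π u = components π v := by
  ext i
  fin_cases i
  · exact h0
  · exact h1
  · change components π u 2 = components π v 2
    exact mul_left_cancel (a := components π u 0 * components π u 1)
      ((components_prod u).trans ((components_prod v).symm.trans (by rw [h0, h1])))

/-- The element of `K̃(G, 3)` represented by a triple with product in `F'`. -/
def KTilde.ofTriple (π : F →* G) (a b c : F) (h : a * b * c ∈ commutator F) : KTilde π 3 :=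
  QuotientGroup.mk ⟨![a, b, c], mem_K_three.2 h⟩

theorem mk_eq_one_iff (e : K F 3) : (QuotientGroup.mk e : KTilde π 3) = 1 ↔
    (∀ i, π (e.1 i) = 1) ∧ ((e.1 0 * e.1 1 * e.1 2 : F) : CentralQuotient π) = 1 := by
  rw [QuotientGroup.eq_one_iff, Subgroup.mem_subgroupOf, mem_KSubClosure_three]

/-- A commutator of triples has entries in `N`, since `G` is abelian; only its product modulo `[N,
F]` matters. -/
theorem comm_eq_one_iff_pairing (hπ : Function.Surjective π) (u v : KTilde π 3) :
    comm u v = 1 ↔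
      pairing hπ (components π u 0) (components π v 0) *
        pairing hπ (components π u 1) (components π v 1) *
        pairing hπ (components π u 2) (components π v 2) = 1 := by
  induction u using QuotientGroup.induction_on with
  | H e =>
  induction v using QuotientGroup.induction_on with
  | H f =>
    have h : comm (QuotientGroup.mk e : KTilde π 3) (QuotientGroup.mk f) =
      QuotientGroup.mk (comm e f) := (map_comm (QuotientGroup.mk' _) e f).symm
    rw [h, mk_eq_one_iff]
    have hc : ∀ i, (comm e f).1 i = comm (e.1 i) (f.1 i) := fun i => rfl
    simp only [hc, components_mk, Subtype.ext_iff, Subgroup.coe_mul, pairing_apply,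
      QuotientGroup.mk_mul]
    refine and_iff_right fun i => ?_
    rw [map_comm, comm_eq_one_iff, mul_comm]

theorem mem_center_of_components (hπ : Function.Surjective π) {u : KTilde π 3}
    (h : components π u = 1) : u ∈ Subgroup.center (KTilde π 3) :=
  mem_center_of_comm fun v => (comm_eq_one_iff_pairing hπ u v).2 (by simp [h])

theorem comm_mem_center (hπ : Function.Surjective π) (u v : KTilde π 3) :
    comm u v ∈ Subgroup.center (KTilde π 3) :=
  mem_center_of_components hπ (by rw [map_comm, comm_eq_one_iff, mul_comm])

end KTilde

/-! ### Universal property of `τ(G)` for abelian `G` -/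

section TauMaps

variable {G H : Type*} [CommGroup G] [Group H]

/-- The image in `τ(G)` of the first copy of `G`. -/
def tauInl : G →* Tau G :=
  (QuotientGroup.mk' (nabla G)).comp
    ((QuotientGroup.mk' (Subgroup.normalClosure (nuRelators G))).comp Monoid.Coprod.inl)

/-- The image in `τ(G)` of the second copy of `G`. -/
def tauInr : G →* Tau G :=
  (QuotientGroup.mk' (nabla G)).comp
    ((QuotientGroup.mk' (Subgroup.normalClosure (nuRelators G))).comp Monoid.Coprod.inr)

theorem conj_eq_self (x z : G) : conj x z = x := by
  rw [conj, mul_comm, mul_inv_cancel_left]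

theorem conj_eq_self_of_mem_center {x : H} (hx : x ∈ Subgroup.center H) (z : H) :
    conj x z = x := by
  rw [conj, mul_assoc, ← Subgroup.mem_center_iff.1 hx, inv_mul_cancel_left]

theorem map_conj {A : Type*} [Group A] (f : A →* H) (x z : A) :
    f (conj x z) = conj (f x) (f z) := by
  simp [conj]

/-- Two homomorphisms from an abelian group with central mutual commutators that vanish on the
diagonal induce a homomorphism from `τ(G)`. -/
def tauLift (α β : G →* H) (hc : ∀ a b, comm (α a) (β b) ∈ Subgroup.center H)
    (hs : ∀ a, comm (α a) (β a) = 1) : Tau G →* H :=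
  QuotientGroup.lift _
    (QuotientGroup.lift (Subgroup.normalClosure (nuRelators G)) (Monoid.Coprod.lift α β) (by
      intro r hr
      refine Subgroup.normalClosure_le_normal (N := (Monoid.Coprod.lift α β).ker) ?_ hr
      rintro _ ⟨x, y, z, rfl | rfl⟩ <;>
      · rw [SetLike.mem_coe, MonoidHom.mem_ker, map_mul, map_inv, mul_inv_eq_one, map_conj,
          map_comm, map_comm, conj_eq_self, conj_eq_self, Monoid.Coprod.lift_apply_inl,
          Monoid.Coprod.lift_apply_inr, conj_eq_self_of_mem_center (hc x y)]))
    (by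
      intro t ht
      refine (Subgroup.closure_le (K := MonoidHom.ker _)).2 ?_ ht
      rintro _ ⟨x, rfl⟩
      rw [SetLike.mem_coe, MonoidHom.mem_ker, map_comm]
      exact hs x)

variable (α β : G →* H) (hc : ∀ a b, comm (α a) (β b) ∈ Subgroup.center H)
  (hs : ∀ a, comm (α a) (β a) = 1)

theorem tauLift_inl (a : G) : tauLift α β hc hs (tauInl a) = α a :=
  Monoid.Coprod.lift_apply_inl α β a

theorem tauLift_inr (a : G) : tauLift α β hc hs (tauInr a) = β a :=
  Monoid.Coprod.lift_apply_inr α β a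

theorem tau_induction {p : Tau G → Prop} (hl : ∀ a, p (tauInl a)) (hr : ∀ a, p (tauInr a))
    (hm : ∀ s t, p s → p t → p (s * t)) (t : Tau G) : p t := by
  induction t using QuotientGroup.induction_on with
  | H t =>
  induction t using QuotientGroup.induction_on with
  | H t =>
  induction t using Monoid.Coprod.induction_on with
  | inl a => exact hl a
  | inr a => exact hr a
  | mul a b ha hb => exact hm _ _ ha hb

theorem comm_tau_self (a : G) : comm (tauInl a) (tauInr a) = 1 :=
  (map_comm (QuotientGroup.mk' (nabla G)) _ _).symm.trans
    ((QuotientGroup.eq_one_iff _).2 (Subgroup.subset_closure ⟨a, rfl⟩))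

/-- Conjugation in `G` is trivial, so the relations of `ν(G)` say that both copies fix `[a, b*]`. -/
theorem comm_tau_mem_center (a b : G) : comm (tauInl a) (tauInr b) ∈ Subgroup.center (Tau G) := by
  have key : ∀ {t : Tau G}, conj (comm (tauInl a) (tauInr b)) t = comm (tauInl a) (tauInr b) →
      t * comm (tauInl a) (tauInr b) = comm (tauInl a) (tauInr b) * t := by
    intro t ht
    nth_rw 1 [← ht]
    simp [conj, mul_assoc]
  refine Subgroup.mem_center_iff.2 fun t => ?_
  induction t using tau_induction with
  | hl z =>
    refine key ?_
    have := congrArg (QuotientGroup.mk' (nabla G)) (conj_nuInl a b z)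
    rwa [conj_eq_self, conj_eq_self, map_conj, map_comm] at this
  | hr z =>
    refine key ?_
    have := congrArg (QuotientGroup.mk' (nabla G)) (conj_nuInr a b z)
    rwa [conj_eq_self, conj_eq_self, map_conj, map_comm] at this
  | hm s t hs ht => rw [mul_assoc, ht, ← mul_assoc, hs, mul_assoc]

end TauMaps

/-! ### Heisenberg quotients of `τ(G)` -/

section Heisenberg

variable {G W : Type*} [CommGroup G] [CommGroup W]

/-- The bimultiplicative map on `G × G` sending `(a, b), (a', b')` to `ω a b'`. -/
def crossForm (ω : G →* G →* W) : G × G →* G × G →* W :=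
  (MonoidHom.compHom' (MonoidHom.snd G G)).comp (ω.comp (MonoidHom.fst G G))

theorem crossForm_apply (ω : G →* G →* W) (p q : G × G) : crossForm ω p q = ω p.1 q.2 := rfl

theorem CocycleGroup.mem_center {β : G →* G →* W} {p : CocycleGroup β} (h : p.fst = 1) :
    p ∈ Subgroup.center (CocycleGroup β) :=
  Subgroup.mem_center_iff.2 fun q => (CocycleGroup.mul_comm_iff q p).2 (by simp [h])

/-- The homomorphism from `τ(G)` to the Heisenberg group of an alternating form on `G`. -/
def tauHeisenberg (ω : G →* G →* W) (hω : ∀ a, ω a a = 1) :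
    Tau G →* CocycleGroup (crossForm ω) :=
  tauLift
    (MonoidHom.mk' (fun a => ⟨(a, 1), 1⟩) fun a b => by
      ext <;> simp [crossForm_apply])
    (MonoidHom.mk' (fun a => ⟨(1, a), 1⟩) fun a b => by
      ext <;> simp [crossForm_apply])
    (fun a b => CocycleGroup.mem_center (by
      rw [← CocycleGroup.fstHom_apply, map_comm, comm_eq_one_iff, mul_comm]))
    (fun a => by
      rw [comm_eq_one_iff, CocycleGroup.mul_comm_iff]
      simp [crossForm_apply, hω])

theorem tauHeisenberg_inl (ω : G →* G →* W) (hω : ∀ a, ω a a = 1) (a : G) :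
    tauHeisenberg ω hω (tauInl a) = ⟨(a, 1), 1⟩ :=
  tauLift_inl ..

theorem tauHeisenberg_inr (ω : G →* G →* W) (hω : ∀ a, ω a a = 1) (a : G) :
    tauHeisenberg ω hω (tauInr a) = ⟨(1, a), 1⟩ :=
  tauLift_inr ..

/-- Commuting with the second copy of `G` tests the first coordinate, and commuting with the first
copy tests the second. -/
theorem form_eq_one_of_mem_center {ω : G →* G →* W} (hω : ∀ a, ω a a = 1) {t : Tau G}
    (ht : t ∈ Subgroup.center (Tau G)) (x : G) :
    ω (tauHeisenberg ω hω t).fst.1 x = 1 ∧ ω x (tauHeisenberg ω hω t).fst.2 = 1 := by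
  have h : ∀ s, tauHeisenberg ω hω s * tauHeisenberg ω hω t =
      tauHeisenberg ω hω t * tauHeisenberg ω hω s := fun s => by
    rw [← map_mul, Subgroup.mem_center_iff.1 ht, map_mul]
  have h1 := h (tauInl x)
  have h2 := h (tauInr x)
  rw [tauHeisenberg_inl, CocycleGroup.mul_comm_iff] at h1
  rw [tauHeisenberg_inr, CocycleGroup.mul_comm_iff] at h2
  simp only [crossForm_apply, map_one, MonoidHom.one_apply] at h1 h2
  exact ⟨h2.symm, h1⟩

end Heisenberg

/-! ### Comparison of centres: cubes modulo the radical -/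

section Centers

open scoped IsMulCommutative

variable {F G : Type*} [Group F] [CommGroup G] {π : F →* G}

/-- If `τ(G)` and `K̃(G, 3)` are isomorphic, then every element of `G` is a cube modulo the
radical of the commutator pairing. -/
theorem exists_pairing_eq_cube [Finite G] (hπ : Function.Surjective π)
    (e : Tau G ≃* KTilde π 3) (a : G) : ∃ t, pairing hπ a = pairing hπ t ^ 3 := by
  let Q := G ⧸ (pairing hπ).ker
  let q : G →* Q := QuotientGroup.mk' _
  have hq : ∀ {x y : G}, q x = q y ↔ pairing hπ x = pairing hπ y := fun {x y} => by
    rw [← div_eq_one, ← map_div, ← div_eq_one (a := pairing hπ x), ← map_div]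
    exact QuotientGroup.eq_one_iff _
  let T := tauHeisenberg (pairing hπ) (pairing_self hπ)
  let r : Tau G →* G × G := (CocycleGroup.fstHom _).comp T
  let ρ : Tau G →* Q × Q := (q.prodMap q).comp r
  let c : Fin 3 → KTilde π 3 →* G := fun i => (Pi.evalMonoidHom _ i).comp (components π)
  let ψ : KTilde π 3 →* Q × Q := (q.comp (c 0 / c 1)).prod (q.comp (c 1 / c 2))
  have hρ : Function.Surjective ρ := by
    rintro ⟨x, y⟩
    obtain ⟨x, rfl⟩ := QuotientGroup.mk'_surjective _ x
    obtain ⟨y, rfl⟩ := QuotientGroup.mk'_surjective _ y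
    refine ⟨tauInl x * tauInr y, ?_⟩
    simp [ρ, r, T, tauHeisenberg_inl, tauHeisenberg_inr, q]
    exact ⟨rfl, rfl⟩
  have hψ : ∀ u, ψ u = 1 → u ∈ Subgroup.center (KTilde π 3) := by
    intro u hu
    have h1 : q (c 0 u) = q (c 1 u) := div_eq_one.1 (congrArg Prod.fst hu)
    have h2 : q (c 1 u) = q (c 2 u) := div_eq_one.1 (congrArg Prod.snd hu)
    refine mem_center_of_comm fun v => (comm_eq_one_iff_pairing hπ u v).2 ?_
    change pairing hπ (c 0 u) _ * pairing hπ (c 1 u) _ * pairing hπ (c 2 u) _ = 1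
    rw [hq.1 h1, ← hq.1 h2, ← map_mul, ← map_mul, components_prod, map_one]
  have hle : (ψ.comp e.toMonoidHom).ker ≤ ρ.ker := by
    intro t ht
    have h1 : e t ∈ Subgroup.center (KTilde π 3) := hψ _ ht
    have h2 : t ∈ Subgroup.center (Tau G) := by
      refine Subgroup.mem_center_iff.2 fun s => e.injective ?_
      rw [map_mul, map_mul, Subgroup.mem_center_iff.1 h1]
    have h3 := form_eq_one_of_mem_center (pairing_self hπ) h2
    refine Prod.ext ?_ ?_
    · exact (hq (y := 1)).2 (MonoidHom.ext fun x => by rw [map_one]; exact (h3 x).1)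
    · refine (hq (y := 1)).2 (MonoidHom.ext fun x => ?_)
      rw [map_one, pairing_swap]
      exact inv_eq_one.2 (h3 x).2
  -- The index of `ρ.ker` is `|Q × Q|` and divides the order of the range of `ψ ∘ e`, so `ψ ∘ e` is
  -- onto.
  have hcard := Subgroup.index_dvd_of_le hle
  rw [Subgroup.index_ker, Subgroup.index_ker, MonoidHom.range_eq_top.2 hρ,
    Subgroup.card_top] at hcard
  have htop := Subgroup.eq_top_of_le_card _ (Nat.le_of_dvd Nat.card_pos hcard)
  obtain ⟨t, ht⟩ := MonoidHom.range_eq_top.1 htop (q a, 1)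
  have h1 : q (c 0 (e t)) / q (c 1 (e t)) = q a := congrArg Prod.fst ht
  have h2 : q (c 1 (e t)) = q (c 2 (e t)) := div_eq_one.1 (congrArg Prod.snd ht)
  -- In `Q` the last two components agree and the product is 1, so `u₀ = u₁⁻²` and `q a = u₀ / u₁ =
  -- (u₁⁻¹)³`.
  have h3 : q (c 0 (e t) * c 1 (e t) * c 2 (e t)) = 1 := by
    rw [show c 0 (e t) * c 1 (e t) * c 2 (e t) = 1 from components_prod (e t), map_one]
  refine ⟨(c 1 (e t))⁻¹, ?_⟩
  rw [← map_pow, ← hq, ← h1]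
  rw [map_mul, map_mul, ← h2] at h3
  have h4 : q (c 0 (e t)) = (q (c 1 (e t)) * q (c 1 (e t)))⁻¹ :=
    eq_inv_of_mul_eq_one_left (by rwa [← mul_assoc])
  rw [h4, map_pow, map_inv, inv_pow, div_eq_mul_inv, ← mul_inv, pow_succ, pow_two]

end Centers

/-! ### Characters of order three -/

section CubeObstruction

open scoped IsMulCommutative

variable {G X : Type*} [CommGroup G] {π : FreeGroup X →* G}

/-- The product of two characters with values in `ℤ / n`, as a bimultiplicative map. -/
def characterProduct {n : ℕ} (f g : G →* Multiplicative (ZMod n)) :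
    G →* G →* Multiplicative (ZMod n) :=
  MonoidHom.mk' (fun a => MonoidHom.mk' (fun b => .ofAdd ((f a).toAdd * (g b).toAdd))
      fun b b' => by simp [mul_add])
    fun a a' => by ext b; simp [add_mul]

theorem characterProduct_apply {n : ℕ} (f g : G →* Multiplicative (ZMod n)) (a b : G) :
    characterProduct f g a b = .ofAdd ((f a).toAdd * (g b).toAdd) := rfl

/-- Two independent characters of order three obstruct an isomorphism. -/
theorem characters_dependent_of_mulEquiv [Finite G] (hπ : Function.Surjective π)
    (e : Tau G ≃* KTilde π 3) (f g : G →* Multiplicative (ZMod 3)) (a b : G) :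
    (f a).toAdd * (g b).toAdd = (f b).toAdd * (g a).toAdd := by
  obtain ⟨t, ht⟩ := exists_pairing_eq_cube hπ e a
  have h1 : pairing hπ (a / t ^ 3) b = 1 := by
    rw [map_div, map_pow, ht, div_self']; rfl
  have h2 := congrArg Multiplicative.toAdd
    (eq_swap_of_pairing_eq_one hπ (characterProduct f g) h1)
  -- Characters with values in `ℤ/3` do not see `t ^ 3`.
  have h3 : ∀ z : ZMod 3, 3 * z = 0 := by decide
  simpa [characterProduct_apply, h3] using h2

end CubeObstruction

/-! ### Alternating forms on a product of two cyclic groups -/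

section CyclicForms

variable {A B W : Type*} [CommGroup A] [CommGroup B] [CommGroup W]

theorem form_eq_one_of_cyclic {G : Type*} [CommGroup G] {ω : G →* G →* W} (hω : ∀ a, ω a a = 1)
    {C : Type*} [CommGroup C] [IsCyclic C] (i : C →* G) (c c' : C) : ω (i c) (i c') = 1 := by
  obtain ⟨g, hg⟩ := IsCyclic.exists_generator (α := C)
  obtain ⟨k, rfl⟩ := hg c
  obtain ⟨l, rfl⟩ := hg c'
  simp [hω]

/-- An alternating form vanishes on each cyclic factor, so only the mixed values survive. -/
theorem form_prod_cyclic [IsCyclic A] [IsCyclic B] {ω : A × B →* A × B →* W}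
    (hω : ∀ a, ω a a = 1) (a a' : A) (b b' : B) :
    ω (a, b) (a', b') = ω (a, 1) (1, b') * (ω (a', 1) (1, b))⁻¹ := by
  have h1 : ∀ (a : A) (b : B), (a, b) = (a, 1) * (1, b) := by simp
  rw [h1 a b, h1 a' b', map_mul, map_mul, MonoidHom.mul_apply, MonoidHom.mul_apply,
    form_swap hω (a', 1) (1, b), show ω (a, 1) (a', 1) = 1 from
      form_eq_one_of_cyclic hω (MonoidHom.inl A B) a a', show ω (1, b) (1, b') = 1 from
      form_eq_one_of_cyclic hω (MonoidHom.inr A B) b b', one_mul, mul_one, mul_comm]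

theorem form_zpow (ω : A × B →* A × B →* W) (a : A) (b : B) (k l : ℤ) :
    ω (a ^ k, 1) (1, b ^ l) = ω (a, 1) (1, b) ^ (k * l) := by
  have h1 : ((a ^ k, 1) : A × B) = (a, 1) ^ k := by simp
  have h2 : ((1, b ^ l) : A × B) = (1, b) ^ l := by simp
  rw [h1, h2, map_zpow, map_zpow, MonoidHom.zpow_apply, zpow_mul]

/-- The part of a form on `A × B` that pairs the first factor with the second. -/
def mixedForm (ω : A × B →* A × B →* W) : A × B →* A × B →* W :=
  (MonoidHom.compHom' ((MonoidHom.inr A B).comp (MonoidHom.snd A B))).comp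
    (ω.comp ((MonoidHom.inl A B).comp (MonoidHom.fst A B)))

theorem mixedForm_apply (ω : A × B →* A × B →* W) (p q : A × B) :
    mixedForm ω p q = ω (p.1, 1) (1, q.2) := rfl

end CyclicForms

/-! ### Normal form of elements of `τ(G)` -/

section TauPairing

open scoped IsMulCommutative

variable {G : Type*} [CommGroup G]

/-- The pairing `(a, b) ↦ [a, b*]` on `G` with values in the centre of `τ(G)`. -/
def tauPairing : G →* G →* Subgroup.center (Tau G) :=
  MonoidHom.mk' (fun a => MonoidHom.mk' (fun b =>
      (⟨comm (tauInl a) (tauInr b), comm_tau_mem_center a b⟩ : Subgroup.center (Tau G)))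
    (fun b b' => Subtype.ext (by
      simp only [map_mul, Subgroup.coe_mul]
      exact comm_mul_right (comm_tau_mem_center a b) _)))
  (fun a a' => MonoidHom.ext fun b => Subtype.ext (by
      simp only [map_mul, Subgroup.coe_mul, MonoidHom.mul_apply, MonoidHom.mk'_apply]
      exact comm_mul_left (comm_tau_mem_center a b) _))

theorem coe_tauPairing (a b : G) :
    (tauPairing a b : Tau G) = comm (tauInl a) (tauInr b) := rfl

theorem tauPairing_self (a : G) : tauPairing a a = 1 := Subtype.ext (comm_tau_self a)

/-- Moving an element of the second copy past one of the first costs a central value of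
`tauPairing`. This bounds `τ(G)` from above and serves injectivity. -/
theorem exists_eq_mul_of_zpowers {c : Subgroup.center (Tau G)}
    (h : ∀ a b, tauPairing a b ∈ Subgroup.zpowers c) (t : Tau G) :
    ∃ (p q : G) (z : Subgroup.center (Tau G)), z ∈ Subgroup.zpowers c ∧
      t = tauInl p * tauInr q * z := by
  induction t using tau_induction with
  | hl a => exact ⟨a, 1, 1, one_mem _, by simp⟩
  | hr a => exact ⟨1, a, 1, one_mem _, by simp⟩
  | hm s t hs ht =>
    obtain ⟨p, q, z, hz, rfl⟩ := hs
    obtain ⟨p', q', z', hz', rfl⟩ := ht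
    refine ⟨p * p', q * q', (tauPairing p' q)⁻¹ * z * z',
      mul_mem (mul_mem (inv_mem (h _ _)) hz) hz', ?_⟩
    have hzc := fun g => Subgroup.mem_center_iff.1 z.2 g
    have hwc := fun g => Subgroup.mem_center_iff.1 (tauPairing p' q)⁻¹.2 g
    have hsw : tauInr q * tauInl p' =
        tauInl p' * tauInr q * ((tauPairing p' q)⁻¹ : Subgroup.center (Tau G)) := by
      rw [Subgroup.coe_inv, coe_tauPairing]
      simp [comm, mul_assoc]
    simp only [map_mul, Subgroup.coe_mul]
    calc _ = tauInl p * tauInr q * ((z : Tau G) * (tauInl p' * tauInr q')) * z' := by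
          simp only [mul_assoc]
      _ = tauInl p * (tauInr q * tauInl p') * tauInr q' * z * z' := by
          rw [← hzc]; simp only [mul_assoc]
      _ = tauInl p * tauInl p' * tauInr q *
          (((tauPairing p' q)⁻¹ : Subgroup.center (Tau G)) * tauInr q') * z * z' := by
          rw [hsw]; simp only [mul_assoc]
      _ = _ := by
          rw [← hwc]; simp only [mul_assoc]

end TauPairing

/-! ### Homomorphisms into `K̃(A × B, 3)` -/

section LiftToKTilde

open scoped IsMulCommutative

variable {A B F : Type*} [CommGroup A] [CommGroup B] [IsCyclic A] [IsCyclic B] [Group F]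
  {π : F →* A × B}

/-- The entries are powers of one `z` with exponents of sum 0, so the product of their `k`-th powers
is exactly 1. This bounds the order of the image of a generator. -/
theorem pow_triple_eq_one {G : Type*} [CommGroup G] {π : F →* G} {z : F} {c : Fin 3 → ℤ}
    (h : z ^ c 0 * z ^ c 1 * z ^ c 2 ∈ commutator F) (hc : c 0 + c 1 + c 2 = 0) {k : ℕ}
    (hk : π z ^ k = 1) :
    KTilde.ofTriple π (z ^ c 0) (z ^ c 1) (z ^ c 2) h ^ k = 1 := by
  rw [KTilde.ofTriple, ← QuotientGroup.mk_pow, mk_eq_one_iff]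
  have hz : ∀ l : ℤ, (π z ^ l) ^ k = 1 := fun l => by
    rw [← zpow_natCast, ← zpow_mul, mul_comm, zpow_mul, zpow_natCast, hk, one_zpow]
  constructor
  · intro i
    fin_cases i <;> simp [hz]
  · have : ∀ l : ℤ, (z ^ l) ^ k = z ^ (l * k) := fun l => by rw [zpow_mul, zpow_natCast]
    simp [this, ← zpow_add, ← add_mul, hc]

/-- A homomorphism `A × B → K̃(A × B, 3)` with prescribed exponents on the components. -/
theorem exists_lift_of_exponents [Finite A] [Finite B] (hπ : Function.Surjective π)
    (c d : Fin 3 → ℤ)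
    (hc : c 0 + c 1 + c 2 = 0) (hd : d 0 + d 1 + d 2 = 0)
    (hcd : c 0 * d 0 + c 1 * d 1 + c 2 * d 2 = 0) :
    ∃ α : A × B →* KTilde π 3, ∀ a b i, components π (α (a, b)) i = (a ^ c i, b ^ d i) := by
  obtain ⟨x, hx⟩ := IsCyclic.exists_generator (α := A)
  obtain ⟨y, hy⟩ := IsCyclic.exists_generator (α := B)
  obtain ⟨z, hz⟩ := hπ (x, 1)
  obtain ⟨w, hw⟩ := hπ (1, y)
  have h1 : z ^ c 0 * z ^ c 1 * z ^ c 2 ∈ commutator F := by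
    rw [← zpow_add, ← zpow_add, hc, zpow_zero]; exact one_mem _
  have h2 : w ^ d 0 * w ^ d 1 * w ^ d 2 ∈ commutator F := by
    rw [← zpow_add, ← zpow_add, hd, zpow_zero]; exact one_mem _
  let U := KTilde.ofTriple π _ _ _ h1
  let V := KTilde.ofTriple π _ _ _ h2
  have hU : ∀ i, components π U i = (x ^ c i, 1) := fun i => by
    fin_cases i <;> simp [U, KTilde.ofTriple, components_mk, hz]
  have hV : ∀ i, components π V i = (1, y ^ d i) := fun i => by
    fin_cases i <;> simp [V, KTilde.ofTriple, components_mk, hw]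
  have hUx : orderOf U ∣ orderOf x :=
    orderOf_dvd_of_pow_eq_one (pow_triple_eq_one h1 hc (by simp [hz, pow_orderOf_eq_one]))
  have hVy : orderOf V ∣ orderOf y :=
    orderOf_dvd_of_pow_eq_one (pow_triple_eq_one h2 hd (by simp [hw, pow_orderOf_eq_one]))
  -- The condition `hcd` makes the images of the two generators commute.
  have hUV : Commute U V := by
    refine comm_eq_one_iff.1 ((comm_eq_one_iff_pairing hπ U V).2 ?_)
    simp only [hU, hV, form_zpow]
    rw [← zpow_add, ← zpow_add, hcd, zpow_zero]
  let φ := monoidHomOfForallMemZpowers hx hUx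
  let ψ := monoidHomOfForallMemZpowers hy hVy
  have hφ : φ x = U := monoidHomOfForallMemZpowers_apply_gen hx hUx
  have hψ : ψ y = V := monoidHomOfForallMemZpowers_apply_gen hy hVy
  refine ⟨MonoidHom.noncommCoprod φ ψ fun a b => ?_, fun a b i => ?_⟩
  · obtain ⟨k, rfl⟩ := hx a
    obtain ⟨l, rfl⟩ := hy b
    simp only [map_zpow, hφ, hψ]
    exact (hUV.zpow_left k).zpow_right l
  · obtain ⟨k, rfl⟩ := hx a
    obtain ⟨l, rfl⟩ := hy b
    simp [hφ, hψ, hU, hV, ← zpow_mul, mul_comm]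

end LiftToKTilde

/-! ### The isomorphism for a product of two cyclic groups -/

section Isomorphism

open scoped IsMulCommutative

/-- The embedding of `F'` in `K(F, 3)` as the first factor. -/
def firstEntry (F : Type*) [Group F] : commutator F →* K F 3 :=
  ((MonoidHom.mulSingle (fun _ : Fin 3 => F) 0).comp (commutator F).subtype).codRestrict _
    fun f => by rw [mem_K_three]; simp

theorem coe_firstEntry {F : Type*} [Group F] (f : commutator F) :
    (firstEntry F f).1 = Pi.mulSingle 0 f.1 := rfl

/-- Commutators in `K̃` depend only on components, so they all lie in the range. They generate the
image of `F'` in the first entry, which is the whole kernel of `components`. -/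
theorem surjective_of_components {F G H : Type*} [Group F] [CommGroup G] [Group H] {π : F →* G}
    (hπ : Function.Surjective π) (Φ : H →* KTilde π 3)
    (h : ∀ u, ∃ t, components π (Φ t) = components π u) : Function.Surjective Φ := by
  have hcomm : ∀ u v : KTilde π 3, comm u v ∈ Φ.range := by
    intro u v
    obtain ⟨s, hs⟩ := h u
    obtain ⟨t, ht⟩ := h v
    refine ⟨comm s t, ?_⟩
    have key : ∀ {u u' : KTilde π 3} (v : KTilde π 3), components π u = components π u' →
        comm u v = comm u' v := by
      intro u u' v huu
      have hz : u * u'⁻¹ ∈ Subgroup.center (KTilde π 3) :=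
        mem_center_of_components hπ (by rw [map_mul, map_inv, huu, mul_inv_cancel])
      have h1 := comm_eq_one_of_mem_center_left hz v
      calc comm u v = comm (u * u'⁻¹ * u') v := by rw [inv_mul_cancel_right]
        _ = comm u' v := by rw [comm_mul_left (h1 ▸ one_mem _), h1, one_mul]
    rw [map_comm, key _ hs, ← inv_inj, inv_comm, inv_comm, key _ ht]
  have hle : commutator F ≤ (Φ.range.comap ((QuotientGroup.mk' _).comp
      (firstEntry F))).map (Subgroup.subtype _) := by
    refine Subgroup.commutator_le.2 fun e _ f _ => ?_
    have hmem := Subgroup.commutator_mem_commutator (Subgroup.mem_top e) (Subgroup.mem_top f)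
    refine ⟨⟨_, hmem⟩, ?_, rfl⟩
    have h1 : e⁻¹ * e * 1 ∈ commutator F := by simp
    have h2 : f⁻¹ * 1 * f ∈ commutator F := by simp
    -- The two triples overlap nontrivially only in entry 0, where their commutator is `⁅e, f⁆`.
    suffices key : firstEntry F ⟨_, hmem⟩ = comm ⟨![e⁻¹, e, 1], mem_K_three.2 h1⟩
          ⟨![f⁻¹, 1, f], mem_K_three.2 h2⟩ by
      have := hcomm (KTilde.ofTriple π _ _ _ h1) (KTilde.ofTriple π _ _ _ h2)
      change QuotientGroup.mk' ((KSubClosure π.ker 3).subgroupOf (K F 3)) _ ∈ Φ.range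
      rw [key, map_comm]
      exact this
    refine Subtype.ext (funext fun i => ?_)
    rw [coe_firstEntry]
    fin_cases i <;> simp [comm, commutatorElement_def]
  intro u
  obtain ⟨t, ht⟩ := h u
  have hk : u * (Φ t)⁻¹ ∈ Φ.range := by
    have hc : components π (u * (Φ t)⁻¹) = 1 := by rw [map_mul, map_inv, ht, mul_inv_cancel]
    generalize u * (Φ t)⁻¹ = v at hc
    induction v using QuotientGroup.induction_on with
    | H e =>
      obtain ⟨⟨f, hf⟩, hf', hfe⟩ := hle (mem_K_three.1 e.2)
      change f = _ at hfe
      subst hfe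
      suffices key : (QuotientGroup.mk e : KTilde π 3) = QuotientGroup.mk
          (firstEntry F ⟨_, hf⟩) by
        rw [key]
        exact hf'
      rw [← inv_mul_eq_one]
      refine (mk_eq_one_iff _).2 ?_
      have he : ∀ i, π (e.1 i) = 1 := fun i => congrFun hc i
      constructor
      · intro i
        fin_cases i <;> simp [coe_firstEntry, he]
      · have h1 := Subgroup.mem_center_iff.1 (mk_mem_center π (he 1))
        have h2 := Subgroup.mem_center_iff.1 (mk_mem_center π (he 2))
        simp only [coe_firstEntry, Subgroup.coe_mul, Subgroup.coe_inv, Pi.mul_apply,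
          Pi.inv_apply, Pi.mulSingle_eq_same, ne_eq, one_ne_zero, not_false_eq_true,
          Pi.mulSingle_eq_of_ne, Fin.reduceEq, QuotientGroup.mk_mul, QuotientGroup.mk_inv,
          mul_one, mul_assoc, inv_mul_cancel_left]
        rw [← mul_assoc, ← mul_inv_rev, mul_inv_eq_one]
        exact h2 _
  obtain ⟨s, hs⟩ := hk
  exact ⟨s * t, by rw [map_mul, hs, inv_mul_cancel_right]⟩

variable {A B X : Type*} [CommGroup A] [CommGroup B] [IsCyclic A] [IsCyclic B] [Finite A]
  [Finite B] {π : FreeGroup X →* A × B}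

/-- The mixed part of `tauPairing` is trivial at the swapped arguments, so its antisymmetrisation
there is `tauPairing` itself. -/
theorem tauPairing_eq_one_of_pairing {A B X : Type*} [CommGroup A] [CommGroup B]
    {π : FreeGroup X →* A × B} (hπ : Function.Surjective π) {a : A} {b : B}
    (h : pairing hπ (a, 1) (1, b) = 1) : tauPairing ((a, 1) : A × B) (1, b) = 1 := by
  have h1 := eq_swap_of_pairing_eq_one hπ (mixedForm (tauPairing (G := A × B))) h
  rw [mixedForm_apply, mixedForm_apply] at h1
  exact h1.trans (by rw [Prod.mk_one_one, map_one])

/-- The isomorphism `τ(A × B) ≅ K̃(A × B, 3)` for finite cyclic groups `A` and `B`, where the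
order of `B` is prime to three. -/
theorem nonempty_mulEquiv_of_prod_cyclic (hB : (Nat.card B).Coprime 3)
    (hπ : Function.Surjective π) : Nonempty (Tau (A × B) ≃* KTilde π 3) := by
  -- With these exponents the commutator of `α (a, b)` and `β (a', b')` is governed by `s ^ 3 / t ^
  -- 3`, where `s` pairs `a'` with `b` and `t` pairs `a` with `b'`; it vanishes on the diagonal.
  obtain ⟨α, hα⟩ := exists_lift_of_exponents hπ ![1, 0, -1] ![1, -2, 1] (by simp) (by simp)
    (by simp)
  obtain ⟨β, hβ⟩ := exists_lift_of_exponents hπ ![0, 1, -1] ![-2, 1, 1] (by simp) (by simp)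
    (by simp)
  have hcomm : ∀ a b a' b', comm (α (a, b)) (β (a', b')) = 1 ↔
      pairing hπ (a', 1) (1, b) ^ 3 = pairing hπ (a, 1) (1, b') ^ 3 := by
    intro a b a' b'
    rw [comm_eq_one_iff_pairing hπ]
    have hp := fun i => form_prod_cyclic (pairing_self hπ) (a ^ (![1, 0, -1] : Fin 3 → ℤ) i)
      (a' ^ (![0, 1, -1] : Fin 3 → ℤ) i) (b ^ (![1, -2, 1] : Fin 3 → ℤ) i)
      (b' ^ (![-2, 1, 1] : Fin 3 → ℤ) i)
    simp only [hα, hβ]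
    rw [hp 0, hp 1, hp 2]
    simp only [form_zpow]
    generalize pairing hπ (a', 1) (1, b) = s, pairing hπ (a, 1) (1, b') = t
    have h : t ^ (![1, 0, -1] 0 * ![-2, 1, 1] 0 : ℤ) *
        (s ^ (![0, 1, -1] 0 * ![1, -2, 1] 0 : ℤ))⁻¹ *
        (t ^ (![1, 0, -1] 1 * ![-2, 1, 1] 1 : ℤ) *
          (s ^ (![0, 1, -1] 1 * ![1, -2, 1] 1 : ℤ))⁻¹) *
        (t ^ (![1, 0, -1] 2 * ![-2, 1, 1] 2 : ℤ) *
          (s ^ (![0, 1, -1] 2 * ![1, -2, 1] 2 : ℤ))⁻¹) = s ^ 3 / t ^ 3 := by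
      simp [div_eq_mul_inv, pow_succ]
      ac_rfl
    rw [h, div_eq_one]
  have hself : ∀ a, comm (α a) (β a) = 1 := fun ⟨a, b⟩ => (hcomm a b a b).2 rfl
  let Φ := tauLift α β (fun a b => comm_mem_center hπ _ _) hself
  have hl : ∀ a, Φ (tauInl a) = α a := tauLift_inl _ _ _ _
  have hr : ∀ a, Φ (tauInr a) = β a := tauLift_inr _ _ _ _
  have hsurj : Function.Surjective Φ := by
    refine surjective_of_components hπ Φ fun u => ?_
    -- On `B` one solves `s r⁻² = u₀` and `s⁻² r = u₁`: then `r = s² u₁` and `s³ = (u₁² u₀)⁻¹`.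
    obtain ⟨s, hs⟩ := (powCoprime hB).surjective
      ((components π u 1).2 ^ 2 * (components π u 0).2)⁻¹
    rw [powCoprime_apply] at hs
    refine ⟨tauInl ((components π u 0).1, s) *
      tauInr ((components π u 1).1, s ^ 2 * (components π u 1).2), components_eq_of_eq ?_ ?_⟩
    · rw [map_mul, hl, hr, map_mul, Pi.mul_apply, hα, hβ]
      refine Prod.ext (by simp) ?_
      have h : (components π u 0).2 = (s ^ 3)⁻¹ * ((components π u 1).2 ^ 2)⁻¹ := by
        rw [hs, inv_inv, mul_inv_cancel_comm]
      rw [h]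
      have key : ∀ s g : B, s * ((s ^ 2 * g) ^ 2)⁻¹ = (s ^ 3)⁻¹ * (g ^ 2)⁻¹ := fun s g => by
        rw [mul_pow, ← pow_mul, mul_inv, ← mul_assoc]
        congr 1
        group
      simpa using key s _
    · rw [map_mul, hl, hr, map_mul, Pi.mul_apply, hα, hβ]
      refine Prod.ext (by simp) ?_
      simp
  have hinj : Function.Injective Φ := by
    rw [injective_iff_map_eq_one]
    intro t ht
    obtain ⟨x, hx⟩ := IsCyclic.exists_generator (α := A)
    obtain ⟨y, hy⟩ := IsCyclic.exists_generator (α := B)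
    let c : Subgroup.center (Tau (A × B)) := tauPairing (x, 1) (1, y)
    have hc : ∀ p q, tauPairing p q ∈ Subgroup.zpowers c := by
      rintro ⟨a, b⟩ ⟨a', b'⟩
      obtain ⟨k, rfl⟩ := hx a
      obtain ⟨l, rfl⟩ := hy b
      obtain ⟨k', rfl⟩ := hx a'
      obtain ⟨l', rfl⟩ := hy b'
      rw [form_prod_cyclic tauPairing_self]
      simp only [form_zpow]
      exact mul_mem (zpow_mem (Subgroup.mem_zpowers c) _)
        (inv_mem (zpow_mem (Subgroup.mem_zpowers c) _))
    obtain ⟨⟨a, b⟩, ⟨a', b'⟩, _, ⟨k, rfl⟩, rfl⟩ := exists_eq_mul_of_zpowers hc t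
    have hck : ((c ^ k : Subgroup.center (Tau (A × B))) : Tau (A × B)) =
        comm (tauInl (x ^ k, 1)) (tauInr (1, y)) := by
      rw [← coe_tauPairing]
      have := form_zpow tauPairing x y k 1
      rw [zpow_one, mul_one] at this
      rw [this]
    rw [hck, map_mul, map_mul, map_comm, hl, hr, hl, hr] at ht
    have h0 := congrArg (components π) ht
    have h1 : ∀ u v, components π (comm u v) = 1 := fun u v => by
      rw [map_comm, comm_eq_one_iff, mul_comm]
    rw [map_mul, map_mul, h1, mul_one, map_one] at h0
    have h2 := congrFun h0 0
    have h3 := congrFun h0 1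
    simp only [Pi.mul_apply, hα, hβ] at h2 h3
    obtain ⟨rfl, hb⟩ : a = 1 ∧ b * (b' ^ 2)⁻¹ = 1 := by simpa using h2
    obtain ⟨rfl, hb'⟩ : a' = 1 ∧ (b ^ 2)⁻¹ * b' = 1 := by simpa using h3
    obtain rfl := inv_mul_eq_one.1 hb'
    obtain rfl : b = 1 := by
      refine (powCoprime hB).injective ?_
      rw [powCoprime_one, powCoprime_apply, ← inv_eq_one, ← hb]
      group
    -- Only the central part remains; its image being trivial kills the cube of a value of
    -- `pairing`.
    have hd : pairing hπ ((x ^ k) ^ 3, 1) (1, y) = 1 := by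
      simp only [one_pow, Prod.mk_one_one, map_one, one_mul] at ht
      have h4 := form_zpow (pairing hπ) (x ^ k) y 3 1
      rw [zpow_one, mul_one] at h4
      have h5 := (hcomm _ _ _ _).1 ht
      rw [Prod.mk_one_one, map_one, one_pow] at h5
      exact_mod_cast h4.trans h5.symm
    have h6 := tauPairing_eq_one_of_pairing hπ hd
    have h7 : tauPairing (x ^ k, 1) (1, y) ^ 3 = 1 := by
      rw [← h6, ← MonoidHom.pow_apply, ← map_pow, Prod.pow_mk, one_pow]
    have h8 : tauPairing (x ^ k, 1) (1, y) ^ Nat.card B = 1 := by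
      rw [← map_pow, Prod.pow_mk, one_pow, pow_card_eq_one', Prod.mk_one_one, map_one]
    -- The value is killed both by 3 and by `|B|`, which are coprime.
    have h9 := pow_gcd_eq_one.2 ⟨h8, h7⟩
    rw [hB, pow_one] at h9
    rw [hck, ← coe_tauPairing, h9, OneMemClass.coe_one, mul_one, one_pow,
      Prod.mk_one_one, map_one, map_one, mul_one]
  exact ⟨MulEquiv.ofBijective Φ ⟨hinj, hsurj⟩⟩

end Isomorphism

/-! ### Finite abelian groups: torsion counts, splittings and characters -/

section AbelianGroups

/-- The `p`-torsion subgroup of an abelian group. -/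
abbrev powKer (p : ℕ) (G : Type*) [CommGroup G] : Subgroup G := (powMonoidHom p : G →* G).ker

theorem mem_powKer {p : ℕ} {G : Type*} [CommGroup G] {g : G} : g ∈ powKer p G ↔ g ^ p = 1 := Iff.rfl

theorem card_powKer_le {p : ℕ} {G H : Type*} [CommGroup G] [CommGroup H] [Finite H] (f : G →* H)
    (hf : Function.Injective f) : Nat.card (powKer p G) ≤ Nat.card (powKer p H) :=
  Nat.card_le_card_of_injective
    (fun g => (⟨f g, by rw [mem_powKer, ← map_pow, mem_powKer.1 g.2, map_one]⟩ : powKer p H))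
    fun a b h => Subtype.ext (hf (congrArg Subtype.val h))

theorem card_powKer_prod (p : ℕ) (A B : Type*) [CommGroup A] [CommGroup B] :
    Nat.card (powKer p (A × B)) = Nat.card (powKer p A) * Nat.card (powKer p B) := by
  have h : powKer p (A × B) = (powKer p A).prod (powKer p B) := by
    ext ⟨a, b⟩
    simp [Subgroup.mem_prod, MonoidHom.mem_ker]
  rw [h, Nat.card_congr (Subgroup.prodEquiv _ _).toEquiv, Nat.card_prod]

theorem le_card_powKer {p : ℕ} [Fact p.Prime] {G : Type*} [CommGroup G] [Finite G]
    (h : p ∣ Nat.card G) : p ≤ Nat.card (powKer p G) := by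
  obtain ⟨x, hx⟩ := exists_prime_orderOf_dvd_card' p h
  have hle : Subgroup.zpowers x ≤ powKer p G := by
    rw [Subgroup.zpowers_le, mem_powKer, ← hx, pow_orderOf_eq_one]
  calc p = Nat.card (Subgroup.zpowers x) := by rw [Nat.card_zpowers, hx]
    _ ≤ _ := Nat.le_of_dvd Nat.card_pos (Subgroup.card_dvd_of_le hle)

theorem card_powKer_eq_index (p : ℕ) (G : Type*) [CommGroup G] [Finite G] :
    Nat.card (powKer p G) = Nat.card (G ⧸ (powMonoidHom p : G →* G).range) :=
  Subgroup.index_range.symm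

theorem pow_quotient_eq_one {p : ℕ} {G : Type*} [CommGroup G]
    (q : G ⧸ (powMonoidHom p : G →* G).range) : q ^ p = 1 := by
  induction q using QuotientGroup.induction_on with
  | H g => exact (QuotientGroup.eq_one_iff _).2 ⟨g, rfl⟩

theorem card_powKer_dvd (p : ℕ) (G : Type*) [CommGroup G] [Finite G] :
    Nat.card (powKer p G) ∣ p ^ Group.rank G := by
  rw [card_powKer_eq_index]
  refine (card_dvd_exponent_pow_rank' _ pow_quotient_eq_one).trans (pow_dvd_pow _ ?_)
  exact Group.rank_le_of_surjective (QuotientGroup.mk' _) (QuotientGroup.mk'_surjective _)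

theorem card_powKer_sylow {p : ℕ} [Fact p.Prime] {G : Type*} [CommGroup G] [Finite G]
    (P : Sylow p G) : Nat.card (powKer p P) = Nat.card (powKer p G) := by
  refine le_antisymm (card_powKer_le P.1.subtype P.1.subtype_injective) ?_
  have hP : ∀ g : G, g ^ p = 1 → g ∈ P := by
    intro g hg
    have h1 : IsPGroup p (Subgroup.zpowers g) := by
      refine IsPGroup.of_card_dvd_pow (n := 1) ?_
      rw [Nat.card_zpowers, pow_one]
      exact orderOf_dvd_of_pow_eq_one hg
    obtain ⟨Q, hQ⟩ := h1.exists_le_sylow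
    have : Subsingleton (Sylow p G) :=
      (Sylow.unique_of_normal P inferInstance).instSubsingleton
    rw [Subsingleton.elim P Q]
    exact hQ (Subgroup.mem_zpowers g)
  exact Nat.card_le_card_of_injective
    (fun g => (⟨⟨g, hP _ g.2⟩, Subtype.ext g.2⟩ : powKer p P))
    fun a b h => Subtype.ext (congrArg (fun x : powKer p P => (x.1 : G)) h)

/-- A finite abelian group splits off a cyclic subgroup whose order is the exponent. -/
theorem exists_mulEquiv_cyclic_prod (G : Type*) [CommGroup G] [Finite G] :
    ∃ A B : Subgroup G, IsCyclic A ∧ Nat.card A = Monoid.exponent G ∧ Nonempty (G ≃* A × B) := by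
  obtain ⟨x, hx⟩ := Monoid.exists_orderOf_eq_exponent (G := G) Monoid.ExponentExists.of_finite
  let A := Subgroup.zpowers x
  have hA : Nat.card A = Monoid.exponent G := by rw [Nat.card_zpowers, hx]
  have : NeZero (Nat.card A) := ⟨Nat.card_pos.ne'⟩
  have : NeZero (Monoid.exponent G) := ⟨Monoid.exponent_ne_zero_of_finite⟩
  -- A faithful character of `A` extends to `G`; the kernel of the extension is the complement.
  let χ : A ≃* rootsOfUnity (Nat.card A) ℂ := mulEquivOfCyclicCardEq (by
    rw [HasEnoughRootsOfUnity.natCard_rootsOfUnity])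
  obtain ⟨f, hf⟩ := MonoidHom.domRestrict_surjective (M := ℂ) A
    ((rootsOfUnity (Nat.card A) ℂ).subtype.comp χ.toMonoidHom)
  have hf' : ∀ a : A, f a = χ a := fun a => DFunLike.congr_fun hf a
  let φ : A × f.ker →* G := A.subtype.coprod f.ker.subtype
  have hinj : Function.Injective φ := by
    rw [injective_iff_map_eq_one]
    rintro ⟨a, b⟩ hab
    have h1 : (a : G) * b = 1 := hab
    have h2 := congrArg f h1
    rw [map_mul, show f b = 1 from b.2, mul_one, hf', map_one] at h2
    have h3 : a = 1 := χ.injective (Subtype.ext (h2.trans (by simp)))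
    subst h3
    refine Prod.ext rfl (Subtype.ext ?_)
    simpa using h1
  have hsurj : Function.Surjective φ := by
    intro g
    -- Since `|A|` is the exponent of `G`, the extension takes no values beyond those on `A`.
    have hg : f g ∈ rootsOfUnity (Nat.card A) ℂ := by
      rw [mem_rootsOfUnity, ← map_pow, hA, Monoid.pow_exponent_eq_one, map_one]
    obtain ⟨a, ha⟩ := χ.surjective ⟨_, hg⟩
    refine ⟨(a, ⟨(a : G)⁻¹ * g, ?_⟩), ?_⟩
    · rw [MonoidHom.mem_ker, map_mul, map_inv, hf', ha, inv_mul_cancel]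
    · simp [φ]
  exact ⟨A, f.ker, inferInstance, hA, ⟨(MulEquiv.ofBijective φ ⟨hinj, hsurj⟩).symm⟩⟩

theorem dvd_card_of_prime_dvd_card {p : ℕ} [Fact p.Prime] {G A B : Type*} [CommGroup G] [Finite G]
    [CommGroup A] [CommGroup B] [Finite B] (e : G ≃* A × B) (hA : Nat.card A = Monoid.exponent G)
    (hB : p ∣ Nat.card B) : p ∣ Nat.card A := by
  obtain ⟨x, hx⟩ := exists_prime_orderOf_dvd_card' p hB
  rw [hA, ← hx, ← orderOf_injective (e.symm.toMonoidHom.comp (MonoidHom.inr A B))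
    (e.symm.injective.comp fun a b h => congrArg Prod.snd h)]
  exact Monoid.order_dvd_exponent _

/-- A prime dividing `|B|` divides the exponent `|A|`, so `A` contributes at least `p` further
torsion elements as a factor. -/
theorem mul_card_powKer_le {p : ℕ} [Fact p.Prime] {G A B : Type*} [CommGroup G] [Finite G]
    [CommGroup A] [CommGroup B] [Finite A] [Finite B] (e : G ≃* A × B)
    (hA : Nat.card A = Monoid.exponent G) (hB : p ∣ Nat.card B) :
    p * Nat.card (powKer p B) ≤ Nat.card (powKer p G) :=
  calc _ ≤ Nat.card (powKer p A) * Nat.card (powKer p B) :=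
        Nat.mul_le_mul_right _ (le_card_powKer (dvd_card_of_prime_dvd_card e hA hB))
    _ = Nat.card (powKer p (A × B)) := (card_powKer_prod p A B).symm
    _ ≤ _ := card_powKer_le e.symm.toMonoidHom e.symm.injective

theorem isCyclic_of_card_powKer_lt {p : ℕ} [Fact p.Prime] {P : Type*} [CommGroup P] [Finite P]
    (hP : IsPGroup p P) (h : Nat.card (powKer p P) < p * p) : IsCyclic P := by
  obtain ⟨A, B, _, hA, ⟨e⟩⟩ := exists_mulEquiv_cyclic_prod P
  by_cases hB : p ∣ Nat.card B
  · exact absurd ((Nat.mul_le_mul_left p (le_card_powKer hB)).trans (mul_card_powKer_le e hA hB))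
      (not_le.2 h)
  · have : Subsingleton B := by
      by_contra hne
      rw [not_subsingleton_iff_nontrivial] at hne
      exact hB ((hP.to_subgroup B).card_eq_or_dvd.resolve_left Finite.one_lt_card.ne')
    refine isCyclic_of_injective ((MonoidHom.fst A B).comp e.toMonoidHom) ?_
    exact Function.Injective.comp (g := Prod.fst)
      (fun a b h => Prod.ext h (Subsingleton.elim _ _)) e.injective

/-- All Sylow subgroups are cyclic, and an abelian group with this property is cyclic. -/
theorem isCyclic_of_card_powKer_lt_forall {B : Type*} [CommGroup B] [Finite B]
    (h : ∀ (p : ℕ) [Fact p.Prime], p ∣ Nat.card B → Nat.card (powKer p B) < p * p) :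
    IsCyclic B := by
  have : IsZGroup B := by
    refine ⟨fun p hp P => ?_⟩
    have : Fact p.Prime := ⟨hp⟩
    by_cases hd : p ∣ Nat.card B
    · exact isCyclic_of_card_powKer_lt P.isPGroup' ((card_powKer_sylow P).trans_lt (h p hd))
    · have : Subsingleton P := by
        by_contra hne
        rw [not_subsingleton_iff_nontrivial] at hne
        exact hd ((P.isPGroup'.card_eq_or_dvd.resolve_left Finite.one_lt_card.ne').trans
          (Subgroup.card_subgroup_dvd_card _))
      infer_instance
  infer_instance

theorem rank_le_one_of_isCyclic (G : Type*) [Group G] [Finite G] [IsCyclic G] :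
    Group.rank G ≤ 1 := by
  obtain ⟨g, hg⟩ := IsCyclic.exists_generator (α := G)
  refine Group.rank_le (S := {g}) ?_
  rw [Finset.coe_singleton, ← Subgroup.zpowers_eq_closure, Subgroup.eq_top_iff']
  exact hg

/-- A finite abelian group whose Sylow subgroups have rank at most two and whose Sylow
`q`-subgroups are cyclic is a product of two cyclic groups, the second of order prime to `q`. -/
theorem exists_mulEquiv_prod_cyclic {G : Type*} [CommGroup G] [Finite G] {q : ℕ} [Fact q.Prime]
    (h : ∀ (p : ℕ) [Fact p.Prime] (P : Sylow p G), Group.rank P ≤ 2)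
    (hq : ∀ P : Sylow q G, IsCyclic P) :
    ∃ A B : Subgroup G, IsCyclic A ∧ IsCyclic B ∧ (Nat.card B).Coprime q ∧
      Nonempty (G ≃* A × B) := by
  obtain ⟨A, B, hAc, hA, ⟨e⟩⟩ := exists_mulEquiv_cyclic_prod G
  have hle : ∀ (p : ℕ) [Fact p.Prime] (r : ℕ) (P : Sylow p G), Group.rank P ≤ r →
      Nat.card (powKer p G) ≤ p ^ r := fun p hp r P hr => by
    rw [← card_powKer_sylow P]
    exact Nat.le_of_dvd (pow_pos hp.out.pos _)
      ((card_powKer_dvd p P).trans (pow_dvd_pow _ hr))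
  refine ⟨A, B, hAc, isCyclic_of_card_powKer_lt_forall fun p hp hd => ?_, ?_, ⟨e⟩⟩
  · have h1 := (mul_card_powKer_le e hA hd).trans (hle p 2 default (h p default))
    rw [pow_two] at h1
    have h2 := Nat.le_of_mul_le_mul_left h1 hp.out.pos
    exact h2.trans_lt (by nlinarith [hp.out.two_le])
  · rw [Nat.coprime_comm, Nat.Prime.coprime_iff_not_dvd Fact.out]
    intro hd
    have : IsCyclic (default : Sylow q G) := hq default
    have h1 := (Nat.mul_le_mul_left q (le_card_powKer hd)).trans ((mul_card_powKer_le e hA hd).trans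
      (hle q 1 default (rank_le_one_of_isCyclic _)))
    have := (Fact.out : q.Prime).two_le
    nlinarith

theorem exists_independent_functionals {p : ℕ} [Fact p.Prime] {V : Type*} [AddCommGroup V]
    [Module (ZMod p) V] [Finite V] (hcard : p * p ≤ Nat.card V) :
    ∃ (f g : V →+ ZMod p) (x y : V), f x * g y ≠ f y * g x := by
  have hrank : 1 < Module.finrank (ZMod p) V := by
    rw [Module.natCard_eq_pow_finrank (K := ZMod p), Nat.card_zmod, ← pow_two] at hcard
    exact (Nat.pow_le_pow_iff_right (Fact.out : p.Prime).one_lt).1 hcard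
  let b := Module.finBasis (ZMod p) V
  let i : Fin (Module.finrank (ZMod p) V) := ⟨0, by omega⟩
  let j : Fin (Module.finrank (ZMod p) V) := ⟨1, hrank⟩
  have hij : i ≠ j := by simp [i, j]
  refine ⟨(b.coord i).toAddMonoidHom, (b.coord j).toAddMonoidHom, b i, b j, ?_⟩
  simp [hij, hij.symm]

/-- If a Sylow `p`-subgroup of a finite abelian group is not cyclic, there are two independent
characters of order `p`. -/
theorem exists_independent_characters {G : Type*} [CommGroup G] [Finite G] {p : ℕ} [Fact p.Prime]
    (P : Sylow p G) (hP : ¬ IsCyclic P) :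
    ∃ (f g : G →* Multiplicative (ZMod p)) (a b : G),
      (f a).toAdd * (g b).toAdd ≠ (f b).toAdd * (g a).toAdd := by
  let Q := G ⧸ (powMonoidHom p : G →* G).range
  -- `G / Gᵖ` is an `𝔽_p`-space with as many elements as the `p`-torsion, hence of dimension at
  -- least 2.
  let : Module (ZMod p) (Additive Q) :=
    AddCommGroup.zmodModule fun v => pow_quotient_eq_one (G := G) v.toMul
  have hcard : p * p ≤ Nat.card (Additive Q) := by
    refine le_trans ?_ (card_powKer_eq_index p G).le
    rw [← card_powKer_sylow P]
    exact not_lt.1 fun h => hP (isCyclic_of_card_powKer_lt P.isPGroup' h)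
  obtain ⟨f, g, x, y, h⟩ := exists_independent_functionals hcard
  obtain ⟨a, ha⟩ := QuotientGroup.mk_surjective x.toMul
  obtain ⟨b, hb⟩ := QuotientGroup.mk_surjective y.toMul
  let χ : (Additive Q →+ ZMod p) → G →* Multiplicative (ZMod p) := fun f =>
    MonoidHom.mk' (fun g => .ofAdd (f (.ofMul (g : Q)))) fun g h => by
      rw [QuotientGroup.mk_mul, ofMul_mul, map_add, ofAdd_add]
  refine ⟨χ f, χ g, a, b, ?_⟩
  change f (.ofMul (a : Q)) * g (.ofMul (b : Q)) ≠ f (.ofMul (b : Q)) * g (.ofMul (a : Q))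
  rw [ha, hb]
  exact h

end AbelianGroups

/-! ### Transport along isomorphisms of `G` -/

section Transport

variable {G H F : Type*} [CommGroup G] [CommGroup H] [Group F]

/-- The homomorphism `τ(G) → τ(H)` induced by a homomorphism of abelian groups. -/
def tauMap (f : G →* H) : Tau G →* Tau H :=
  tauLift (tauInl.comp f) (tauInr.comp f) (fun _ _ => comm_tau_mem_center _ _)
    fun _ => comm_tau_self _

theorem tauMap_inl (f : G →* H) (a : G) : tauMap f (tauInl a) = tauInl (f a) := tauLift_inl ..

theorem tauMap_inr (f : G →* H) (a : G) : tauMap f (tauInr a) = tauInr (f a) := tauLift_inr ..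

theorem tauMap_tauMap {f : G →* H} {g : H →* G} (h : ∀ a, g (f a) = a) (t : Tau G) :
    tauMap g (tauMap f t) = t := by
  induction t using tau_induction with
  | hl a => rw [tauMap_inl, tauMap_inl, h]
  | hr a => rw [tauMap_inr, tauMap_inr, h]
  | hm s t hs ht => rw [map_mul, map_mul, hs, ht]

/-- An isomorphism of abelian groups induces an isomorphism of the groups `τ`. -/
def tauCongr (e : G ≃* H) : Tau G ≃* Tau H where
  toFun := tauMap e
  invFun := tauMap e.symm
  left_inv := tauMap_tauMap e.symm_apply_apply
  right_inv := tauMap_tauMap e.apply_symm_apply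
  map_mul' := map_mul _

/-- The group `K̃` depends only on the kernel of the presentation. -/
def kTildeCongr (π : F →* G) (e : G ≃* H) (n : ℕ) :
    KTilde ((e : G →* H).comp π) n ≃* KTilde π n :=
  QuotientGroup.quotientMulEquivOfEq (by rw [MonoidHom.ker_mulEquiv_comp])

end Transport

end LiedtkeTau

theorem mainTheorem5 {G : Type*} [CommGroup G] [Finite G] {X : Type*} [Finite X]
    (π : FreeGroup X →* G) (hπ : Function.Surjective π) :
    ((∀ (p : ℕ) [Fact p.Prime] (P : Sylow p G), Group.rank P ≤ 2) →
      (Nonempty (LiedtkeTau.Tau G ≃* LiedtkeTau.KTilde π 3) ↔ ∀ P : Sylow 3 G, IsCyclic P)) ∧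
    (∀ P : Sylow 3 G, 2 ≤ Group.rank P →
      ¬ Nonempty (LiedtkeTau.Tau G ≃* LiedtkeTau.KTilde π 3)) := by
  have h3 : ∀ P : Sylow 3 G, ¬ IsCyclic P →
      ¬ Nonempty (LiedtkeTau.Tau G ≃* LiedtkeTau.KTilde π 3) := by
    rintro P hP ⟨e⟩
    obtain ⟨f, g, a, b, h⟩ := LiedtkeTau.exists_independent_characters P hP
    exact h (LiedtkeTau.characters_dependent_of_mulEquiv hπ e f g a b)
  refine ⟨fun hrank => ⟨fun he P => by_contra fun hP => h3 P hP he, fun hcyc => ?_⟩,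
    fun P hP => h3 P fun _ => absurd (LiedtkeTau.rank_le_one_of_isCyclic P) (by omega)⟩
  obtain ⟨A, B, _, _, hB, ⟨e⟩⟩ := LiedtkeTau.exists_mulEquiv_prod_cyclic hrank hcyc
  obtain ⟨Φ⟩ := LiedtkeTau.nonempty_mulEquiv_of_prod_cyclic
    (π := (e : G →* A × B).comp π) hB (e.surjective.comp hπ)
  exact ⟨(LiedtkeTau.tauCongr e).trans (Φ.trans (LiedtkeTau.kTildeCongr π e 3))⟩
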